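/- A metric graph $\Gamma=(G,\ell)$ is the compact connected metric space obtained from a finite connected nonempty graph $G$ (loops and parallel edges allowed) by identifying each edge $e$ with an interval of length $\ell(e)>0$ and taking the path metric. Its genus is $g=\dim H_1(\Gamma,\mathbb{R})$. Let $\mathrm{Div}(\Gamma)$ be the free abelian group on the points of $\Gamma$, with degree map $\deg(\sum_x a_x x)=\sum_x a_x$, and let $\mathrm{Div}^0(\Gamma)=\ker(\deg)$. A divisor $\sum_x a_x x$ is effective if all $a_x\ge 0$. For a continuous piecewise linear function $f:\Gamma\to\mathbb{R}$ (with finitely many pieces) with integer slopes, let $\mathrm{Div}(f)=-\sum_{x\in\Gamma} a_x(f)\,x$, where $a_x(f)$ is the sum of the outgoing slopes of $f$ at $x$. The Jacobian $\mathrm{Jac}(\Gamma)$ is the quotient of $\mathrm{Div}^0(\Gamma)$ by the subgroup of all the divisors $\mathrm{Div}(f)$. For an integer $d\ge 1$, the metric graph $\Gamma$ satisfies the degree-$d$ Manin--Mumford condition if, for every effective divisor $D$ of degree $d$, the image of the Abel--Jacobi map $$\Gamma^d\to\mathrm{Jac}(\Gamma),\qquad (x_1,\dots,x_d)\mapsto[x_1+\cdots+x_d-D]$$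 contains only finitely many torsion points of $\mathrm{Jac}(\Gamma)$. Theorem. There is an absolute constant $M$ such that, for every metric graph $\Gamma$ of genus $g\ge 1$ and every integer $d\ge 1$, if $\Gamma$ satisfies the degree-$d$ Manin--Mumford condition, then $d<M\log g$. -/

import Mathlib

noncomputable section

/-- A compact connected metric graph `Γ = (G, ℓ)`, presented by a combinatorial model: a nonempty
connected multigraph (loops and parallel edges allowed) with vertices `V` and edges `E`, which are
finite types wherever this is used, and a positive length for each edge.  The points of `Γ` are
given by `MetricGraph.Point` below. -/
structure MetricGraph (V E : Type*) where
  tail : E → V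
  head : E → V
  length : E → ℝ
  length_pos : ∀ e, 0 < length e
  nonempty : Nonempty V
  connected : ∀ u v : V, Relation.EqvGen (fun a b => ∃ e, tail e = a ∧ head e = b) u v

namespace MetricGraph

variable {V E : Type*}

/-- The cellular boundary map `C₁(Γ, ℝ) → C₀(Γ, ℝ)`, `e ↦ head e - tail e`. -/
def boundary (Γ : MetricGraph V E) : (E →₀ ℝ) →ₗ[ℝ] (V →₀ ℝ) :=
  Finsupp.linearCombination ℝ
    (fun e => Finsupp.single (Γ.head e) (1 : ℝ) - Finsupp.single (Γ.tail e) (1 : ℝ))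

/-- The genus `dim H₁(Γ, ℝ)`.  There are no cells of dimension two, so `H₁` is the space of
cycles, i.e. the kernel of the boundary map. -/
def genus (Γ : MetricGraph V E) : ℕ :=
  Module.finrank ℝ (LinearMap.ker Γ.boundary)

/-- The points of the metric graph: each edge `e` is a copy of `[0, ℓ(e)]`, glued to the vertices
at its two ends.  As a set this is the disjoint union of the vertices and of the open edges. -/
inductive Point (Γ : MetricGraph V E) where
  | vertex (v : V) : Point Γ
  | interior (e : E) (t : ℝ) (ht : t ∈ Set.Ioo 0 (Γ.length e)) : Point Γ

/-- The arc length parametrization `[0, ℓ(e)] → Γ` of the edge `e`, from its tail to its head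
(extended to `ℝ` by constants; only the values on `[0, ℓ(e)]` matter). -/
def edgePoint (Γ : MetricGraph V E) (e : E) (t : ℝ) : Γ.Point :=
  if h₀ : t ≤ 0 then Point.vertex (Γ.tail e)
  else if h₁ : Γ.length e ≤ t then Point.vertex (Γ.head e)
  else Point.interior e t ⟨not_le.mp h₀, not_le.mp h₁⟩

/-- `f : Γ → ℝ` is piecewise `ℤ`-linear: each edge has a finite set `S` of break points such that,
in the arc length parameter, `f` is affine with an integer slope on each closed subinterval of
`[0, ℓ(e)]` with no break point in its interior.  (Such an `f` is automatically continuous.) -/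
def IsPLInt (Γ : MetricGraph V E) (f : Γ.Point → ℝ) : Prop :=
  ∀ e : E, ∃ S : Finset ℝ, ∀ a b : ℝ, 0 ≤ a → a ≤ b → b ≤ Γ.length e →
    (∀ s ∈ S, s ∉ Set.Ioo a b) →
    ∃ m : ℤ, ∀ t ∈ Set.Icc a b,
      f (Γ.edgePoint e t) = f (Γ.edgePoint e a) + (m : ℝ) * (t - a)

/-- The slope of `f` at the point `t` of the edge `e`, in the direction of the head of `e`. -/
def slopeForward (Γ : MetricGraph V E) (f : Γ.Point → ℝ) (e : E) (t : ℝ) : ℝ :=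
  derivWithin (fun s => f (Γ.edgePoint e s)) (Set.Ici t) t

/-- The slope of `f` at the point `t` of the edge `e`, in the direction of the tail of `e`. -/
def slopeBackward (Γ : MetricGraph V E) (f : Γ.Point → ℝ) (e : E) (t : ℝ) : ℝ :=
  -derivWithin (fun s => f (Γ.edgePoint e s)) (Set.Iic t) t

open Classical in
/-- The sum of the slopes of `f` at a point over all directions leaving that point (a loop at a
vertex contributes two directions). -/
def outgoingSlope [Fintype E] (Γ : MetricGraph V E) (f : Γ.Point → ℝ) : Γ.Point → ℝ
  | Point.vertex v =>
      (∑ e : E, if Γ.tail e = v then Γ.slopeForward f e 0 else 0) +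
        ∑ e : E, if Γ.head e = v then Γ.slopeBackward f e (Γ.length e) else 0
  | Point.interior e t _ => Γ.slopeForward f e t + Γ.slopeBackward f e t

/-- The group `Div(Γ)` of divisors: the free abelian group on the points of `Γ`. -/
abbrev Divisor (Γ : MetricGraph V E) : Type _ := Γ.Point →₀ ℤ

/-- The degree `∑ aₓ x ↦ ∑ aₓ`. -/
def degree (Γ : MetricGraph V E) : Γ.Divisor →+ ℤ :=
  Finsupp.liftAddHom (fun _ => AddMonoidHom.id ℤ)

theorem isPLInt_zero (Γ : MetricGraph V E) : Γ.IsPLInt (fun _ => 0) :=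
  fun _ => ⟨∅, fun _ _ _ _ _ _ => ⟨0, fun _ _ => by simp⟩⟩

theorem IsPLInt.add {Γ : MetricGraph V E} {f g : Γ.Point → ℝ} (hf : Γ.IsPLInt f)
    (hg : Γ.IsPLInt g) : Γ.IsPLInt (fun x => f x + g x) := by
  classical
  intro e
  obtain ⟨S, hS⟩ := hf e
  obtain ⟨T, hT⟩ := hg e
  refine ⟨S ∪ T, fun a b ha hab hb h => ?_⟩
  obtain ⟨m, hm⟩ := hS a b ha hab hb fun s hs => h s (Finset.mem_union_left _ hs)
  obtain ⟨n, hn⟩ := hT a b ha hab hb fun s hs => h s (Finset.mem_union_right _ hs)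
  refine ⟨m + n, fun t ht => ?_⟩
  beta_reduce
  rw [hm t ht, hn t ht]
  push_cast
  ring

theorem IsPLInt.neg {Γ : MetricGraph V E} {f : Γ.Point → ℝ} (hf : Γ.IsPLInt f) :
    Γ.IsPLInt (fun x => -f x) := by
  intro e
  obtain ⟨S, hS⟩ := hf e
  refine ⟨S, fun a b ha hab hb h => ?_⟩
  obtain ⟨m, hm⟩ := hS a b ha hab hb h
  refine ⟨-m, fun t ht => ?_⟩
  beta_reduce
  rw [hm t ht]
  push_cast
  ring

/-- There is room without break points to the right of any point. -/
theorem exists_gap_right (S : Finset ℝ) {t c : ℝ} (h : t < c) :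
    ∃ b, t < b ∧ b ≤ c ∧ ∀ s ∈ S, s ∉ Set.Ioo t b := by
  induction S using Finset.induction_on with
  | empty => exact ⟨c, h, le_rfl, by simp⟩
  | insert x S _ ih =>
    obtain ⟨b, hb, hbc, hS⟩ := ih
    by_cases hx : t < x
    · refine ⟨min b x, lt_min hb hx, (min_le_left _ _).trans hbc, fun s hs hs' => ?_⟩
      rcases Finset.mem_insert.mp hs with rfl | hs
      · exact absurd (hs'.2.trans_le (min_le_right _ _)) (lt_irrefl _)
      · exact hS s hs ⟨hs'.1, hs'.2.trans_le (min_le_left _ _)⟩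
    · refine ⟨b, hb, hbc, fun s hs hs' => ?_⟩
      rcases Finset.mem_insert.mp hs with rfl | hs
      · exact hx hs'.1
      · exact hS s hs hs'

/-- There is room without break points to the left of any point. -/
theorem exists_gap_left (S : Finset ℝ) {t c : ℝ} (h : c < t) :
    ∃ a, a < t ∧ c ≤ a ∧ ∀ s ∈ S, s ∉ Set.Ioo a t := by
  induction S using Finset.induction_on with
  | empty => exact ⟨c, h, le_rfl, by simp⟩
  | insert x S _ ih =>
    obtain ⟨a, ha, hca, hS⟩ := ih
    by_cases hx : x < t
    · refine ⟨max a x, max_lt ha hx, hca.trans (le_max_left _ _), fun s hs hs' => ?_⟩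
      rcases Finset.mem_insert.mp hs with rfl | hs
      · exact absurd ((le_max_right _ _).trans_lt hs'.1) (lt_irrefl _)
      · exact hS s hs ⟨(le_max_left _ _).trans_lt hs'.1, hs'.2⟩
    · refine ⟨a, ha, hca, fun s hs hs' => ?_⟩
      rcases Finset.mem_insert.mp hs with rfl | hs
      · exact hx hs'.2
      · exact hS s hs hs'

theorem IsPLInt.differentiableWithinAt_Ici {Γ : MetricGraph V E} {f : Γ.Point → ℝ}
    (hf : Γ.IsPLInt f) {e : E} {t : ℝ} (ht : 0 ≤ t) (ht' : t < Γ.length e) :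
    DifferentiableWithinAt ℝ (fun s => f (Γ.edgePoint e s)) (Set.Ici t) t := by
  obtain ⟨S, hS⟩ := hf e
  obtain ⟨b, htb, hbc, hgap⟩ := exists_gap_right S ht'
  obtain ⟨m, hm⟩ := hS t b ht htb.le hbc hgap
  have h : DifferentiableWithinAt ℝ (fun s => f (Γ.edgePoint e t) + (m : ℝ) * (s - t))
      (Set.Ici t) t := by fun_prop
  refine h.congr_of_eventuallyEq ?_ (by simp)
  filter_upwards [Icc_mem_nhdsGE htb] with s hs using hm s hs

theorem IsPLInt.differentiableWithinAt_Iic {Γ : MetricGraph V E} {f : Γ.Point → ℝ}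
    (hf : Γ.IsPLInt f) {e : E} {t : ℝ} (ht : 0 < t) (ht' : t ≤ Γ.length e) :
    DifferentiableWithinAt ℝ (fun s => f (Γ.edgePoint e s)) (Set.Iic t) t := by
  obtain ⟨S, hS⟩ := hf e
  obtain ⟨a, hat, hca, hgap⟩ := exists_gap_left S ht
  obtain ⟨m, hm⟩ := hS a t hca hat.le ht' hgap
  have h : DifferentiableWithinAt ℝ (fun s => f (Γ.edgePoint e a) + (m : ℝ) * (s - a))
      (Set.Iic t) t := by fun_prop
  refine h.congr_of_eventuallyEq ?_ (hm t ⟨hat.le, le_rfl⟩)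
  filter_upwards [Icc_mem_nhdsLE hat] with s hs using hm s hs

theorem IsPLInt.slopeForward_add {Γ : MetricGraph V E} {f g : Γ.Point → ℝ} (hf : Γ.IsPLInt f)
    (hg : Γ.IsPLInt g) {e : E} {t : ℝ} (ht : 0 ≤ t) (ht' : t < Γ.length e) :
    Γ.slopeForward (fun x => f x + g x) e t = Γ.slopeForward f e t + Γ.slopeForward g e t :=
  derivWithin_fun_add (hf.differentiableWithinAt_Ici ht ht')
    (hg.differentiableWithinAt_Ici ht ht')

theorem IsPLInt.slopeBackward_add {Γ : MetricGraph V E} {f g : Γ.Point → ℝ} (hf : Γ.IsPLInt f)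
    (hg : Γ.IsPLInt g) {e : E} {t : ℝ} (ht : 0 < t) (ht' : t ≤ Γ.length e) :
    Γ.slopeBackward (fun x => f x + g x) e t = Γ.slopeBackward f e t + Γ.slopeBackward g e t := by
  unfold slopeBackward
  rw [derivWithin_fun_add (hf.differentiableWithinAt_Iic ht ht')
    (hg.differentiableWithinAt_Iic ht ht')]
  ring

theorem IsPLInt.outgoingSlope_add [Fintype E] {Γ : MetricGraph V E} {f g : Γ.Point → ℝ}
    (hf : Γ.IsPLInt f) (hg : Γ.IsPLInt g) (x : Γ.Point) :
    Γ.outgoingSlope (fun x => f x + g x) x = Γ.outgoingSlope f x + Γ.outgoingSlope g x := by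
  cases x with
  | vertex v =>
    have h₁ := fun e => hf.slopeForward_add hg (e := e) le_rfl (Γ.length_pos e)
    have h₂ := fun e => hf.slopeBackward_add hg (e := e) (Γ.length_pos e) le_rfl
    simp only [outgoingSlope, h₁, h₂, ← Finset.sum_filter, Finset.sum_add_distrib]
    ring
  | interior e t ht =>
    simp only [outgoingSlope, hf.slopeForward_add hg ht.1.le ht.2,
      hf.slopeBackward_add hg ht.1 ht.2.le]
    ring

theorem outgoingSlope_neg [Fintype E] (Γ : MetricGraph V E) (f : Γ.Point → ℝ) (x : Γ.Point) :
    Γ.outgoingSlope (fun x => -f x) x = -Γ.outgoingSlope f x := by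
  cases x with
  | vertex v =>
    simp only [outgoingSlope, slopeForward, slopeBackward, derivWithin.fun_neg,
      ← Finset.sum_filter, Finset.sum_neg_distrib]
    ring
  | interior e t ht =>
    simp only [outgoingSlope, slopeForward, slopeBackward, derivWithin.fun_neg]
    ring

theorem outgoingSlope_zero [Fintype E] (Γ : MetricGraph V E) (x : Γ.Point) :
    Γ.outgoingSlope (fun _ => 0) x = 0 := by
  cases x <;> simp [outgoingSlope, slopeForward, slopeBackward]

/-- The subgroup of principal divisors `Div(f)`, for `f` piecewise `ℤ`-linear, where the coefficient
of `Div(f)` at `x` is minus the sum of the outgoing slopes of `f` at `x`. -/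
def principal [Fintype E] (Γ : MetricGraph V E) : AddSubgroup Γ.Divisor where
  carrier := {D | ∃ f : Γ.Point → ℝ, Γ.IsPLInt f ∧ ∀ x, (D x : ℝ) = -Γ.outgoingSlope f x}
  zero_mem' := ⟨fun _ => 0, Γ.isPLInt_zero, fun x => by simp [outgoingSlope_zero]⟩
  add_mem' := by
    rintro D D' ⟨f, hf, hD⟩ ⟨g, hg, hD'⟩
    refine ⟨_, hf.add hg, fun x => ?_⟩
    rw [hf.outgoingSlope_add hg, Finsupp.add_apply, Int.cast_add, hD, hD']
    ring
  neg_mem' := by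
    rintro D ⟨f, hf, hD⟩
    refine ⟨_, hf.neg, fun x => ?_⟩
    rw [outgoingSlope_neg, Finsupp.neg_apply, Int.cast_neg, hD]

/-- The Jacobian `Jac(Γ) = Div⁰(Γ) / Div(PL_ℤ(Γ))`: divisors of degree zero modulo principal
divisors. -/
abbrev Jac [Fintype E] (Γ : MetricGraph V E) : Type _ :=
  Γ.degree.ker ⧸ Γ.principal.addSubgroupOf Γ.degree.ker

/-- The divisor `x₁ + ⋯ + x_d`. -/
def pointSum (Γ : MetricGraph V E) {d : ℕ} (x : Fin d → Γ.Point) : Γ.Divisor :=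
  ∑ i, Finsupp.single (x i) (1 : ℤ)

theorem degree_pointSum (Γ : MetricGraph V E) {d : ℕ} (x : Fin d → Γ.Point) :
    Γ.degree (Γ.pointSum x) = d := by
  simp [degree, pointSum]

/-- The degree `d` Abel--Jacobi map `Γ^d → Jac(Γ)`, `(x₁, …, x_d) ↦ [x₁ + ⋯ + x_d - D]`, where `D`
is a divisor of degree `d`. -/
def abelJacobi [Fintype E] (Γ : MetricGraph V E) {d : ℕ} (D : Γ.Divisor) (hD : Γ.degree D = d)
    (x : Fin d → Γ.Point) : Γ.Jac :=
  QuotientAddGroup.mk ⟨Γ.pointSum x - D, by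
    rw [AddMonoidHom.mem_ker, map_sub, degree_pointSum, hD, sub_self]⟩

/-- The degree `d` Manin--Mumford condition: for each effective divisor `D` of degree `d`, the image
of the Abel--Jacobi map based at `D` contains only finitely many torsion points of the Jacobian. -/
def ManinMumford [Fintype E] (Γ : MetricGraph V E) (d : ℕ) : Prop :=
  ∀ (D : Γ.Divisor) (hD : Γ.degree D = d), 0 ≤ D →
    (Set.range (Γ.abelJacobi D hD) ∩ {a : Γ.Jac | ∃ n : ℕ, 0 < n ∧ n • a = 0}).Finite

end MetricGraph

end

/-! Pair chains by `⟨z, y⟩ = ∑ z e * length e * y e`. A divisor that moves one point on each edge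
`e` from `a e` to `b e` is principal exactly when `m e * length e + (b e - a e)` annihilates the
cycle space for some integral cycle `m`: the edge increments then come from a potential on the
vertices, and `m` records the slopes near the vertices.

Suppose a nonzero integral cycle `z` has a functional `⟨z, ·⟩` on cycles that is a combination, with
coefficients `w`, of at most `d` coordinates, which may be taken linearly independent. Place a point
at the midpoint of each corresponding edge, park the spare points at a vertex, and displace each
midpoint by `-w e / n`. Then `n` times the displacement is balanced by `z`, so the class is torsion.
For large `n` these classes are distinct: a small principal displacement can only be balanced by the
zero cycle (`eq_zero_of_balanced`), and independence then forces it to vanish. Hence Manin–Mumford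
fails in degree `d` (`not_maninMumford_of_cycle`).

It remains to find a cycle whose support involves only logarithmically many coordinates up to
proportionality. Edges at a vertex of valence at most two can be contracted without adding a
proportionality class (`HasLowRankCycle.of_contract`). Once all non-isolated vertices have valence
at least three, balls grow exponentially until a short cycle appears, as in the Moore bound
(`hasLowRankCycle_of_three_le_valence`). Genus one is separate because `log 1 = 0`: there a single
coordinate suffices. -/

noncomputable section

/-! ### Cycles and potentials. -/

/-- The cycle space of the multigraph with edges `E` running from `t e` to `h e`: the chains
orthogonal to all coboundaries. -/
def cycleSpace {V E : Type*} [Fintype E] (t h : E → V) : Submodule ℝ (E → ℝ) where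
  carrier := {y | ∀ f : V → ℝ, ∑ e, y e * (f (h e) - f (t e)) = 0}
  zero_mem' := fun f => by simp
  add_mem' := by
    intro y y' hy hy' f
    simp only [Pi.add_apply, add_mul, Finset.sum_add_distrib, hy f, hy' f, add_zero]
  smul_mem' := by
    intro c y hy f
    simp only [Pi.smul_apply, smul_eq_mul, mul_assoc, ← Finset.mul_sum, hy f, mul_zero]

theorem mem_cycleSpace {V E : Type*} [Fintype E] {t h : E → V} {y : E → ℝ} :
    y ∈ cycleSpace t h ↔ ∀ f : V → ℝ, ∑ e, y e * (f (h e) - f (t e)) = 0 :=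
  Iff.rfl

/-- A cochain that vanishes on all cycles is a coboundary. -/
theorem exists_potential {V E : Type*} [Fintype E] (t h : E → V) (s : E → ℝ)
    (hs : ∀ y ∈ cycleSpace t h, ∑ e, s e * y e = 0) :
    ∃ p : V → ℝ, ∀ e, p (h e) - p (t e) = s e := by
  classical
  let δ : (V → ℝ) →ₗ[ℝ] (E → ℝ) := LinearMap.funLeft ℝ ℝ h - LinearMap.funLeft ℝ ℝ t
  by_cases hmem : s ∈ LinearMap.range δ
  · obtain ⟨p, hp⟩ := hmem
    exact ⟨p, fun e => by rw [← hp]; simp [δ, LinearMap.funLeft]⟩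
  · exfalso
    -- A functional separating `s` from the coboundaries is, in coordinates, a cycle that pairs
    -- nontrivially with `s`.
    obtain ⟨φ, hφ, hker⟩ := Submodule.exists_le_ker_of_notMem hmem
    have hexp : ∀ x : E → ℝ, φ x = ∑ e, x e * φ (Pi.single e 1) := fun x => by
      conv_lhs => rw [pi_eq_sum_univ' x]
      simp [map_sum]
    apply hφ
    rw [hexp]
    refine hs (fun e => φ (Pi.single e 1)) fun f => ?_
    have := hker (LinearMap.mem_range_self δ f)
    rw [LinearMap.mem_ker, hexp] at this
    simpa [δ, LinearMap.funLeft, mul_comm] using this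

/-! ### Piecewise affine functions on an interval. -/

/-- The ramp function with corner `a`. -/
def ramp (a s : ℝ) : ℝ := max (s - a) 0

theorem ramp_of_le {a s : ℝ} (h : s ≤ a) : ramp a s = 0 := max_eq_right (by linarith)

theorem ramp_of_ge {a s : ℝ} (h : a ≤ s) : ramp a s = s - a := max_eq_left (by linarith)

theorem hasDerivWithinAt_ramp_Ici (a t : ℝ) :
    HasDerivWithinAt (ramp a) (if a ≤ t then 1 else 0) (Set.Ici t) t := by
  split_ifs with h
  · refine ((hasDerivWithinAt_id t _).sub_const a).congr (fun s hs => ?_) (ramp_of_ge h)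
    exact ramp_of_ge (h.trans hs)
  · refine (hasDerivWithinAt_const t _ (0 : ℝ)).congr_of_eventuallyEq ?_
      (ramp_of_le (not_le.mp h).le)
    filter_upwards [Icc_mem_nhdsGE (not_le.mp h)] with s hs using ramp_of_le hs.2

theorem hasDerivWithinAt_ramp_Iic (a t : ℝ) :
    HasDerivWithinAt (ramp a) (if a < t then 1 else 0) (Set.Iic t) t := by
  split_ifs with h
  · refine ((hasDerivWithinAt_id t _).sub_const a).congr_of_eventuallyEq ?_ (ramp_of_ge h.le)
    filter_upwards [Icc_mem_nhdsLE h] with s hs using ramp_of_ge hs.1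
  · refine (hasDerivWithinAt_const t _ (0 : ℝ)).congr (fun s hs => ?_)
      (ramp_of_le (not_lt.mp h))
    exact ramp_of_le ((show s ≤ t from hs).trans (not_lt.mp h))

/-- `F` is piecewise affine with integer slopes on `[0, L]`. -/
def PLOn (F : ℝ → ℝ) (L : ℝ) : Prop :=
  ∃ S : Finset ℝ, ∀ a b : ℝ, 0 ≤ a → a ≤ b → b ≤ L → (∀ s ∈ S, s ∉ Set.Ioo a b) →
    ∃ m : ℤ, ∀ t ∈ Set.Icc a b, F t = F a + (m : ℝ) * (t - a)

theorem PLOn.add {F G : ℝ → ℝ} {L : ℝ} (hF : PLOn F L) (hG : PLOn G L) :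
    PLOn (fun s => F s + G s) L := by
  classical
  obtain ⟨S, hS⟩ := hF
  obtain ⟨T, hT⟩ := hG
  refine ⟨S ∪ T, fun a b ha hab hb h => ?_⟩
  obtain ⟨m, hm⟩ := hS a b ha hab hb fun s hs => h s (Finset.mem_union_left _ hs)
  obtain ⟨n, hn⟩ := hT a b ha hab hb fun s hs => h s (Finset.mem_union_right _ hs)
  refine ⟨m + n, fun t ht => ?_⟩
  beta_reduce
  rw [hm t ht, hn t ht]
  push_cast
  ring

theorem PLOn.int_mul {F : ℝ → ℝ} {L : ℝ} (hF : PLOn F L) (n : ℤ) :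
    PLOn (fun s => n * F s) L := by
  obtain ⟨S, hS⟩ := hF
  refine ⟨S, fun a b ha hab hb h => ?_⟩
  obtain ⟨m, hm⟩ := hS a b ha hab hb h
  refine ⟨n * m, fun t ht => ?_⟩
  beta_reduce
  rw [hm t ht]
  push_cast
  ring

theorem PLOn.congr {F G : ℝ → ℝ} {L : ℝ} (hF : PLOn F L)
    (h : ∀ s ∈ Set.Icc 0 L, G s = F s) : PLOn G L := by
  obtain ⟨S, hS⟩ := hF
  refine ⟨S, fun a b ha hab hb hgap => ?_⟩
  obtain ⟨m, hm⟩ := hS a b ha hab hb hgap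
  refine ⟨m, fun t ht => ?_⟩
  rw [h t ⟨ha.trans ht.1, ht.2.trans hb⟩, h a ⟨ha, hab.trans hb⟩, hm t ht]

theorem plOn_affine (c : ℝ) (m : ℤ) (L : ℝ) : PLOn (fun s => c + m * s) L :=
  ⟨∅, fun a b _ _ _ _ => ⟨m, fun t _ => by ring⟩⟩

theorem plOn_ramp (a L : ℝ) : PLOn (ramp a) L := by
  refine ⟨{a}, fun u v _ _ _ h => ?_⟩
  have h := h a (Finset.mem_singleton_self a)
  by_cases hau : a ≤ u
  · refine ⟨1, fun t ht => ?_⟩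
    rw [ramp_of_ge hau, ramp_of_ge (hau.trans ht.1)]
    push_cast
    ring
  · have hva : v ≤ a := not_lt.mp fun hav => h ⟨not_le.mp hau, hav⟩
    refine ⟨0, fun t ht => ?_⟩
    rw [ramp_of_le (not_le.mp hau).le, ramp_of_le (ht.2.trans hva)]
    simp

/-- A piecewise affine function whose one-sided derivatives agree in the interior is affine. -/
theorem PLOn.affine {F : ℝ → ℝ} {L : ℝ} (hL : 0 ≤ L) (hF : PLOn F L)
    (h : ∀ t ∈ Set.Ioo 0 L, derivWithin F (Set.Ici t) t = derivWithin F (Set.Iic t) t) :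
    ∃ m : ℤ, ∀ t ∈ Set.Icc 0 L, F t = F 0 + m * t := by
  classical
  obtain ⟨S, hS⟩ := hF
  induction S using Finset.induction_on with
  | empty =>
    obtain ⟨m, hm⟩ := hS 0 L le_rfl hL le_rfl (by simp)
    exact ⟨m, fun t ht => by rw [hm t ht, sub_zero]⟩
  | insert x S _ ih =>
    -- The break point `x` is superfluous: the slopes on its two sides are the one-sided derivatives
    -- there, which agree.
    refine ih fun a b ha hab hb hgap => ?_
    by_cases hx : x ∈ Set.Ioo a b
    · obtain ⟨m, hm⟩ := hS a x ha hx.1.le (hx.2.le.trans hb) (by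
        intro s hs hs'
        rcases Finset.mem_insert.mp hs with rfl | hs
        · exact lt_irrefl _ hs'.2
        · exact hgap s hs ⟨hs'.1, hs'.2.trans hx.2⟩)
      obtain ⟨n, hn⟩ := hS x b (ha.trans hx.1.le) hx.2.le hb (by
        intro s hs hs'
        rcases Finset.mem_insert.mp hs with rfl | hs
        · exact lt_irrefl _ hs'.1
        · exact hgap s hs ⟨hx.1.trans hs'.1, hs'.2⟩)
      have hl : HasDerivWithinAt F (m : ℝ) (Set.Iic x) x := by
        have h0 : HasDerivWithinAt (fun s => F a + (m : ℝ) * (s - a)) (m * 1 : ℝ)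
            (Set.Iic x) x :=
          (((hasDerivWithinAt_id x _).sub_const a).const_mul (m : ℝ)).const_add (F a)
        rw [mul_one] at h0
        refine h0.congr_of_eventuallyEq ?_ (hm x ⟨hx.1.le, le_rfl⟩)
        filter_upwards [Icc_mem_nhdsLE hx.1] with s hs using hm s hs
      have hr : HasDerivWithinAt F (n : ℝ) (Set.Ici x) x := by
        have h0 : HasDerivWithinAt (fun s => F x + (n : ℝ) * (s - x)) (n * 1 : ℝ)
            (Set.Ici x) x :=
          (((hasDerivWithinAt_id x _).sub_const x).const_mul (n : ℝ)).const_add (F x)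
        rw [mul_one] at h0
        refine h0.congr_of_eventuallyEq ?_ (hn x ⟨le_rfl, hx.2.le⟩)
        filter_upwards [Icc_mem_nhdsGE hx.2] with s hs using hn s hs
      have heq := h x ⟨ha.trans_lt hx.1, hx.2.trans_le hb⟩
      rw [hl.derivWithin (uniqueDiffWithinAt_Iic x),
        hr.derivWithin (uniqueDiffWithinAt_Ici x)] at heq
      refine ⟨m, fun t ht => ?_⟩
      rcases le_total t x with htx | hxt
      · exact hm t ⟨ht.1, htx⟩
      · rw [hn t ⟨hxt, ht.2⟩, hm x ⟨hx.1.le, le_rfl⟩, heq]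
        ring
    · exact hS a b ha hab hb fun s hs hs' => by
        rcases Finset.mem_insert.mp hs with rfl | hs
        · exact hx hs'
        · exact hgap s hs hs'

/-! ### Slopes along an edge. -/

namespace MetricGraph

variable {V E : Type*}

theorem edgePoint_of_mem {Γ : MetricGraph V E} {e : E} {t : ℝ}
    (ht : t ∈ Set.Ioo 0 (Γ.length e)) : Γ.edgePoint e t = Point.interior e t ht := by
  rw [edgePoint, dif_neg (not_le.mpr ht.1), dif_neg (not_le.mpr ht.2)]

theorem edgePoint_zero (Γ : MetricGraph V E) (e : E) :
    Γ.edgePoint e 0 = Point.vertex (Γ.tail e) := by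
  simp [edgePoint]

theorem edgePoint_length (Γ : MetricGraph V E) (e : E) :
    Γ.edgePoint e (Γ.length e) = Point.vertex (Γ.head e) := by
  simp [edgePoint, Γ.length_pos e]

section Slopes

variable {Γ : MetricGraph V E} {f : Γ.Point → ℝ} {e : E} {c m n a b : ℝ}

theorem slopeForward_of_eqOn
    (hf : ∀ s ∈ Set.Icc 0 (Γ.length e),
      f (Γ.edgePoint e s) = c + m * s + n * (ramp a s - ramp b s))
    {t : ℝ} (ht : 0 ≤ t) (ht' : t < Γ.length e) :
    Γ.slopeForward f e t = m + n * ((if a ≤ t then 1 else 0) - (if b ≤ t then 1 else 0)) := by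
  have h0 := (((hasDerivWithinAt_id t (Set.Ici t)).const_mul m).const_add c).add
    (((hasDerivWithinAt_ramp_Ici a t).sub (hasDerivWithinAt_ramp_Ici b t)).const_mul n)
  rw [mul_one] at h0
  refine (h0.congr_of_eventuallyEq ?_ (hf t ⟨ht, ht'.le⟩)).derivWithin
    (uniqueDiffWithinAt_Ici t)
  filter_upwards [Icc_mem_nhdsGE ht'] with s hs using hf s ⟨ht.trans hs.1, hs.2⟩

theorem slopeBackward_of_eqOn
    (hf : ∀ s ∈ Set.Icc 0 (Γ.length e),
      f (Γ.edgePoint e s) = c + m * s + n * (ramp a s - ramp b s))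
    {t : ℝ} (ht : 0 < t) (ht' : t ≤ Γ.length e) :
    Γ.slopeBackward f e t =
      -(m + n * ((if a < t then 1 else 0) - (if b < t then 1 else 0))) := by
  have h0 := (((hasDerivWithinAt_id t (Set.Iic t)).const_mul m).const_add c).add
    (((hasDerivWithinAt_ramp_Iic a t).sub (hasDerivWithinAt_ramp_Iic b t)).const_mul n)
  rw [mul_one] at h0
  refine congrArg Neg.neg ((h0.congr_of_eventuallyEq ?_ (hf t ⟨ht.le, ht'⟩)).derivWithin
    (uniqueDiffWithinAt_Iic t))
  filter_upwards [Icc_mem_nhdsLE ht] with s hs using hf s ⟨hs.1, hs.2.trans ht'⟩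

end Slopes

end MetricGraph

/-! ### Cycles with few independent coordinates. -/

section Cycles

variable {V E : Type*} [Fintype E]

/-- The signed incidence number of the edge `e` at the vertex `v`. -/
def incidence [DecidableEq V] (t h : E → V) (v : V) (e : E) : ℤ :=
  (if h e = v then 1 else 0) - (if t e = v then 1 else 0)

theorem sum_mul_incidence_of_mem [DecidableEq V] {t h : E → V} {y : E → ℝ}
    (hy : y ∈ cycleSpace t h) (v : V) : ∑ e, y e * (incidence t h v e : ℝ) = 0 := by
  have := hy (fun w => if w = v then 1 else 0)
  simpa [incidence] using this

theorem mem_cycleSpace_of_sum_mul_incidence [Fintype V] [DecidableEq V] {t h : E → V}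
    {y : E → ℝ} (hy : ∀ v, ∑ e, y e * (incidence t h v e : ℝ) = 0) : y ∈ cycleSpace t h := by
  intro f
  have h1 : ∀ w : V, f w = ∑ v, f v * (if w = v then 1 else 0) := fun w => by simp
  calc ∑ e, y e * (f (h e) - f (t e))
      = ∑ e, ∑ v, f v * (y e * (incidence t h v e : ℝ)) := by
        refine Finset.sum_congr rfl fun e _ => ?_
        rw [h1 (h e), h1 (t e), ← Finset.sum_sub_distrib, Finset.mul_sum]
        refine Finset.sum_congr rfl fun v _ => ?_
        simp only [incidence]
        push_cast
        ring
    _ = 0 := by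
        rw [Finset.sum_comm]
        simp [← Finset.mul_sum, hy]

/-- There is a nonzero integral cycle such that at most `N` coordinates determine, up to
proportionality on the cycle space, all the coordinates in its support. -/
def HasLowRankCycle (t h : E → V) (N : ℕ) : Prop :=
  ∃ z : E → ℤ, z ≠ 0 ∧ (fun e => (z e : ℝ)) ∈ cycleSpace t h ∧ ∃ I : Finset E, I.card ≤ N ∧
    ∀ e, z e ≠ 0 → ∃ i ∈ I, ∃ c : ℝ, ∀ y ∈ cycleSpace t h, y e = c * y i

theorem hasLowRankCycle_of_card_support_le {t h : E → V} {N : ℕ} {z : E → ℤ} (hz : z ≠ 0)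
    (hzc : (fun e => (z e : ℝ)) ∈ cycleSpace t h)
    (hN : (Finset.univ.filter fun e => z e ≠ 0).card ≤ N) : HasLowRankCycle t h N :=
  ⟨z, hz, hzc, _, hN, fun e he => ⟨e, by simpa using he, 1, fun y _ => by simp⟩⟩

theorem hasLowRankCycle_of_loop {t h : E → V} {N : ℕ} (hN : 1 ≤ N) {e : E} (he : h e = t e) :
    HasLowRankCycle t h N := by
  classical
  refine hasLowRankCycle_of_card_support_le (z := Pi.single e 1) (by simp) (fun f => ?_)
    (le_trans (Finset.card_le_one.mpr ?_) hN)
  · refine Finset.sum_eq_zero fun x _ => ?_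
    by_cases hx : x = e
    · rw [hx, he, sub_self, mul_zero]
    · simp [hx]
  · intro a ha b hb
    simp only [Finset.mem_filter, Finset.mem_univ, true_and, Pi.single_apply, ne_eq,
      ite_eq_right_iff, one_ne_zero, imp_false, not_not] at ha hb
    rw [ha, hb]

end Cycles

/-! ### Contracting an edge. -/

theorem incidence_mul_self {V E : Type*} [DecidableEq V] {t h : E → V} {e : E} {u v : V}
    (huv : u ≠ v)
    (hev : (h e = v ∧ t e = u) ∨ (t e = v ∧ h e = u)) :
    incidence t h v e * incidence t h v e = 1 := by
  rcases hev with ⟨h1, h2⟩ | ⟨h1, h2⟩ <;> simp [incidence, h1, h2, huv]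

theorem sum_eq_add_sum_subtype_ne {E M : Type*} [Fintype E] [DecidableEq E] [AddCommMonoid M] (e : E) (g : E → M) :
    ∑ x, g x = g e + ∑ x : {x // x ≠ e}, g x := by
  rw [← Finset.add_sum_erase _ _ (Finset.mem_univ e)]
  congr 1
  exact (Finset.sum_subtype _ (by simp) g)

theorem update_eq_of_endpoints {V E : Type*} [DecidableEq V] {t h : E → V} {e : E} {u v : V}
    (hev : (h e = v ∧ t e = u) ∨ (t e = v ∧ h e = u)) :
    Function.update id v u (h e) = Function.update id v u (t e) := by
  rcases hev with ⟨h1, h2⟩ | ⟨h1, h2⟩ <;> simp [h1, h2, Function.update_apply]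

section Contraction

variable {V E : Type*} [Fintype E] [DecidableEq V] [DecidableEq E]

/-- The ends of the remaining edges after moving the vertex `v` to `u` and removing `e`. -/
def contractEnd (t : E → V) (e : E) (v u : V) (x : {x // x ≠ e}) : V :=
  Function.update id v u (t x)

variable {t h : E → V} {e : E} {v u : V}

/-- Test functions are pulled back along the retraction sending `v` to `u`; such functions do not
see `e`. -/
theorem restrict_mem_cycleSpace (hev : (h e = v ∧ t e = u) ∨ (t e = v ∧ h e = u)) {y : E → ℝ}
    (hy : y ∈ cycleSpace t h) :
    (fun x : {x // x ≠ e} => y x) ∈ cycleSpace (contractEnd t e v u) (contractEnd h e v u) := by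
  intro f
  have := hy (fun w => f (Function.update id v u w))
  rw [sum_eq_add_sum_subtype_ne e, update_eq_of_endpoints hev, sub_self, mul_zero, zero_add] at this
  exact this

/-- Every function on the vertices is a pullback along the retraction plus a multiple of the
indicator of `v`, so balance at `v` is the only extra condition. -/
theorem mem_cycleSpace_of_restrict (hev : (h e = v ∧ t e = u) ∨ (t e = v ∧ h e = u)) {y : E → ℝ}
    (hy : (fun x : {x // x ≠ e} => y x) ∈
      cycleSpace (contractEnd t e v u) (contractEnd h e v u))
    (hv : ∑ x, y x * (incidence t h v x : ℝ) = 0) : y ∈ cycleSpace t h := by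
  intro f
  have hf : ∀ w, f w = f (Function.update id v u w) + (f v - f u) * (if w = v then 1 else 0) := by
    intro w
    by_cases hw : w = v
    · subst hw; simp
    · simp [hw]
  have h1 : ∑ x, y x * (f (Function.update id v u (h x)) - f (Function.update id v u (t x))) = 0 := by
    rw [sum_eq_add_sum_subtype_ne e, update_eq_of_endpoints hev, sub_self, mul_zero, zero_add]
    exact hy f
  calc ∑ x, y x * (f (h x) - f (t x))
      = ∑ x, y x * (f (Function.update id v u (h x)) - f (Function.update id v u (t x))) +
          (f v - f u) * ∑ x, y x * (incidence t h v x : ℝ) := by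
        rw [Finset.mul_sum, ← Finset.sum_add_distrib]
        refine Finset.sum_congr rfl fun x _ => ?_
        rw [hf (h x), hf (t x)]
        simp only [incidence]
        push_cast
        ring
    _ = 0 := by rw [h1, hv]; ring

/-- Extend a chain by the value at `e` that makes its boundary vanish at `v`. -/
def extendChain {R : Type*} [CommRing R] (t h : E → V) (e : E) (v : V) (y : {x // x ≠ e} → R)
    (x : E) : R :=
  if hx : x = e then -((incidence t h v e : ℤ) : R) * ∑ x', y x' * ((incidence t h v x' : ℤ) : R)
  else y ⟨x, hx⟩

theorem extendChain_mem (huv : u ≠ v) (hev : (h e = v ∧ t e = u) ∨ (t e = v ∧ h e = u))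
    {y : {x // x ≠ e} → ℝ}
    (hy : y ∈ cycleSpace (contractEnd t e v u) (contractEnd h e v u)) :
    extendChain t h e v y ∈ cycleSpace t h := by
  have hr : ∀ x : {x // x ≠ e}, extendChain t h e v y x = y x := fun x => by
    simp [extendChain, x.2]
  refine mem_cycleSpace_of_restrict hev (by simpa only [hr] using hy) ?_
  have h1 : ((incidence t h v e : ℤ) : ℝ) * (incidence t h v e : ℤ) = 1 := by
    exact_mod_cast incidence_mul_self huv hev
  rw [sum_eq_add_sum_subtype_ne e]
  simp only [hr]
  rw [extendChain, dif_pos rfl]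
  linear_combination (-∑ x' : {x // x ≠ e}, y x' * ((incidence t h v x' : ℤ) : ℝ)) * h1

/-- The incidence of `e` at `v` is `±1`, so balance at `v` can be solved for `y e`. -/
theorem apply_eq_of_mem (huv : u ≠ v) (hev : (h e = v ∧ t e = u) ∨ (t e = v ∧ h e = u))
    {y : E → ℝ} (hy : y ∈ cycleSpace t h) :
    y e = -(incidence t h v e : ℝ) *
      ∑ x : {x // x ≠ e}, y x * (incidence t h v x : ℝ) := by
  have h1 : ((incidence t h v e : ℤ) : ℝ) * (incidence t h v e : ℤ) = 1 := by
    exact_mod_cast incidence_mul_self huv hev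
  have h2 := sum_mul_incidence_of_mem hy v
  rw [sum_eq_add_sum_subtype_ne e] at h2
  linear_combination (incidence t h v e : ℝ) * h2 - y e * h1

/-- Extension by `extendChain` shows that each contracted cycle is the restriction of a cycle, so
the genus bound survives contraction. -/
theorem finrank_contract_le (huv : u ≠ v) (hev : (h e = v ∧ t e = u) ∨ (t e = v ∧ h e = u)) :
    Module.finrank ℝ (cycleSpace (contractEnd t e v u) (contractEnd h e v u)) ≤
      Module.finrank ℝ (cycleSpace t h) := by
  refine le_trans (Submodule.finrank_mono (t := (cycleSpace t h).map
    (LinearMap.funLeft ℝ ℝ (Subtype.val : {x // x ≠ e} → E))) fun y hy => ?_)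
    (Submodule.finrank_map_le _ _)
  refine ⟨_, extendChain_mem huv hev hy, ?_⟩
  ext x
  simp [LinearMap.funLeft, extendChain, x.2]

theorem contract_ne_bot (huv : u ≠ v) (hev : (h e = v ∧ t e = u) ∨ (t e = v ∧ h e = u))
    (hne : cycleSpace t h ≠ ⊥) :
    cycleSpace (contractEnd t e v u) (contractEnd h e v u) ≠ ⊥ := by
  obtain ⟨y, hy, hy0⟩ := Submodule.exists_mem_ne_zero_of_ne_bot hne
  refine fun hbot => hy0 ?_
  have h0 : ∀ x : {x // x ≠ e}, y x = 0 := fun x =>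
    congrFun ((Submodule.eq_bot_iff _).mp hbot _ (restrict_mem_cycleSpace hev hy)) x
  ext x
  by_cases hx : x = e
  · rw [hx, apply_eq_of_mem huv hev hy]
    simp [h0]
  · exact h0 ⟨x, hx⟩

/-- By `huniq`, at most one edge other than `e` has nonzero incidence at `v`. If the extended cycle
uses `e`, balance at `v` makes `y e` equal to `±` that edge's coordinate for every cycle `y`, so the
same set `I` still suffices. -/
theorem HasLowRankCycle.of_contract {N : ℕ} (huv : u ≠ v)
    (hev : (h e = v ∧ t e = u) ∨ (t e = v ∧ h e = u))
    (huniq : ∀ x x', x ≠ e → x' ≠ e → incidence t h v x ≠ 0 → incidence t h v x' ≠ 0 → x = x')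
    (hc : HasLowRankCycle (contractEnd t e v u) (contractEnd h e v u) N) :
    HasLowRankCycle t h N := by
  obtain ⟨z, hz, hzc, I, hI, hspan⟩ := hc
  have hcast : (fun x => ((extendChain t h e v z x : ℤ) : ℝ)) =
      extendChain t h e v (fun x => (z x : ℝ)) := by
    ext x
    unfold extendChain
    split_ifs with hx
    · push_cast; rfl
    · rfl
  have hold : ∀ x, x ≠ e → extendChain t h e v z x ≠ 0 →
      ∃ i ∈ I.map (Function.Embedding.subtype _), ∃ c : ℝ, ∀ y ∈ cycleSpace t h,
        y x = c * y i := by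
    intro x hx hzx
    rw [extendChain, dif_neg hx] at hzx
    obtain ⟨i, hi, c, hc⟩ := hspan ⟨x, hx⟩ hzx
    exact ⟨i, Finset.mem_map_of_mem _ hi, c,
      fun y hy => hc _ (restrict_mem_cycleSpace hev hy)⟩
  refine ⟨extendChain t h e v z, fun h0 => hz ?_, ?_, I.map (Function.Embedding.subtype _),
    by rwa [Finset.card_map], fun x hzx => ?_⟩
  · ext x
    simpa [extendChain, x.2] using congrFun h0 x
  · rw [hcast]
    exact extendChain_mem huv hev hzc
  · by_cases hx : x = e
    · rw [hx, extendChain, dif_pos rfl] at hzx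
      obtain ⟨x', -, hx'⟩ := Finset.exists_ne_zero_of_sum_ne_zero (right_ne_zero_of_mul hzx)
      obtain ⟨i, hi, c, hc⟩ := hold x' x'.2 (by
        rw [extendChain, dif_neg x'.2]
        exact left_ne_zero_of_mul hx')
      refine ⟨i, hi, -(incidence t h v e : ℝ) * incidence t h v x' * c, fun y hy => ?_⟩
      rw [hx, apply_eq_of_mem huv hev hy, Finset.sum_eq_single x', hc y hy]
      · ring
      · intro w _ hw
        have : incidence t h v w = 0 := by
          by_contra hne
          exact hw (Subtype.ext
            (huniq w x' w.2 x'.2 hne (Int.cast_ne_zero.mp (right_ne_zero_of_mul hx'))))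
        simp [this]
      · simp
    · exact hold x hx hzx

end Contraction

/-! ### Valences and the Moore bound. -/

open Classical in
/-- The number of half-edges at a vertex. -/
def valence {V E : Type*} [Fintype E] (t h : E → V) (v : V) : ℕ :=
  (Finset.univ.filter fun e => t e = v).card + (Finset.univ.filter fun e => h e = v).card

open Classical in
theorem sum_valence {V E : Type*} [Fintype E] {t h : E → V} (B : Finset V) :
    ∑ v ∈ B, valence t h v = (Finset.univ.filter fun e => t e ∈ B).card +
      (Finset.univ.filter fun e => h e ∈ B).card := by
  have key : ∀ s : E → V, ∑ v ∈ B, (Finset.univ.filter fun e => s e = v).card =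
      (Finset.univ.filter fun e => s e ∈ B).card := by
    intro s
    rw [Finset.card_eq_sum_card_fiberwise (f := s) (t := B) (by simp [Set.MapsTo])]
    refine Finset.sum_congr rfl fun v hv => ?_
    congr 1
    ext e
    simp only [Finset.mem_filter, Finset.mem_univ, true_and]
    exact ⟨fun h1 => ⟨h1 ▸ hv, h1⟩, fun h1 => h1.2⟩
  simp only [valence, Finset.sum_add_distrib, key]

theorem valence_eq_zero_iff {V E : Type*} [Fintype E] {t h : E → V} {v : V} :
    valence t h v = 0 ↔ (∀ e, t e ≠ v) ∧ ∀ e, h e ≠ v := by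
  simp [valence, Finset.filter_eq_empty_iff]

section Moore

variable {V E : Type*} [Fintype V] [Fintype E]

open Classical in
/-- The vertices joined to `v` by an integral chain with at most `j` edges. -/
def chainBall (t h : E → V) (v : V) (j : ℕ) : Finset V :=
  Finset.univ.filter fun w => ∃ p : E → ℤ,
    (∀ f : V → ℝ, ∑ e, (p e : ℝ) * (f (h e) - f (t e)) = f w - f v) ∧
      (Finset.univ.filter fun e => p e ≠ 0).card ≤ j

variable {t h : E → V} {v w : V} {j : ℕ}

theorem mem_chainBall : w ∈ chainBall t h v j ↔ ∃ p : E → ℤ,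
    (∀ f : V → ℝ, ∑ e, (p e : ℝ) * (f (h e) - f (t e)) = f w - f v) ∧
      (Finset.univ.filter fun e => p e ≠ 0).card ≤ j := by
  simp [chainBall]

theorem card_support_add_le {E : Type*} [Fintype E] (p q : E → ℤ) :
    (Finset.univ.filter fun e => (p + q) e ≠ 0).card ≤
      (Finset.univ.filter fun e => p e ≠ 0).card + (Finset.univ.filter fun e => q e ≠ 0).card := by
  classical
  refine le_trans (Finset.card_le_card fun e he => ?_) (Finset.card_union_le _ _)
  simp only [Finset.mem_filter, Finset.mem_univ, true_and, Finset.mem_union, Pi.add_apply] at he ⊢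
  by_contra! h
  exact he (by rw [h.1, h.2, add_zero])

theorem card_support_single_le {E : Type*} [Fintype E] [DecidableEq E] (e : E) (n : ℤ) :
    (Finset.univ.filter fun x => (Pi.single e n : E → ℤ) x ≠ 0).card ≤ 1 := by
  refine Finset.card_le_one.mpr fun a ha b hb => ?_
  simp only [Finset.mem_filter, Finset.mem_univ, true_and, Pi.single_apply, ne_eq,
    ite_eq_right_iff, Classical.not_imp] at ha hb
  rw [ha.1, hb.1]

theorem self_mem_chainBall : v ∈ chainBall t h v j :=
  mem_chainBall.mpr ⟨0, fun f => by simp, by simp⟩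

theorem chain_add_single_mem [DecidableEq E] (hw : w ∈ chainBall t h v j) (e : E)
    (n : ℤ) {w' : V} (hn : ∀ f : V → ℝ, f w + n * (f (h e) - f (t e)) = f w') :
    w' ∈ chainBall t h v (j + 1) := by
  obtain ⟨p, hp, hpj⟩ := mem_chainBall.mp hw
  refine mem_chainBall.mpr ⟨p + Pi.single e n, fun f => ?_, (card_support_add_le _ _).trans
    (add_le_add hpj (card_support_single_le e n))⟩
  have h1 : ∑ x, ((Pi.single e n : E → ℤ) x : ℝ) * (f (h x) - f (t x)) =
      n * (f (h e) - f (t e)) := by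
    rw [Finset.sum_eq_single e] <;> simp +contextual
  simp only [Pi.add_apply, Int.cast_add, add_mul, Finset.sum_add_distrib, hp f, h1]
  linarith [hn f]

theorem mem_chainBall_succ_of_edge {e : E}
    (he : t e ∈ chainBall t h v j ∨ h e ∈ chainBall t h v j) :
    t e ∈ chainBall t h v (j + 1) ∧ h e ∈ chainBall t h v (j + 1) := by
  classical
  rcases he with he | he
  · exact ⟨chain_add_single_mem he e 0 (by simp), chain_add_single_mem he e 1 (by simp)⟩
  · exact ⟨chain_add_single_mem he e (-1) (by simp), chain_add_single_mem he e 0 (by simp)⟩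

open Classical in
/-- If there is no short cycle, then a ball spans at most as many edges as it has vertices. -/
theorem card_edges_le_card_chainBall (hno : ¬ HasLowRankCycle t h (2 * j + 1)) :
    (Finset.univ.filter fun e => t e ∈ chainBall t h v j ∧ h e ∈ chainBall t h v j).card ≤
      (chainBall t h v j).card := by
  choose! p hp hpj using fun w (hw : w ∈ chainBall t h v j) => mem_chainBall.mp hw
  set S := Finset.univ.filter fun e => t e ∈ chainBall t h v j ∧ h e ∈ chainBall t h v j with hS
  -- Otherwise `e` together with the chains to its ends gives a nonzero integral cycle supported on
  -- at most `1 + j + j` edges.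
  have hchain : ∀ e ∈ S, (Pi.single e 1 : E → ℤ) = p (h e) + -p (t e) := by
    intro e he
    obtain ⟨ht, hh⟩ := (Finset.mem_filter.mp he).2
    by_contra hne
    refine hno (hasLowRankCycle_of_card_support_le
      (z := Pi.single e 1 + (p (t e) + -p (h e))) (fun h0 => hne ?_) (fun f => ?_) ?_)
    · rw [eq_neg_of_add_eq_zero_left h0]
      abel
    · have h1 : ∑ x, ((Pi.single e 1 : E → ℤ) x : ℝ) * (f (h x) - f (t x)) =
          f (h e) - f (t e) := by
        rw [Finset.sum_eq_single e] <;> simp +contextual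
      simp only [Pi.add_apply, Pi.neg_apply, Int.cast_add, Int.cast_neg, add_mul, neg_mul,
        Finset.sum_add_distrib, Finset.sum_neg_distrib, hp _ ht f, hp _ hh f, h1]
      ring
    · have h2 : (Finset.univ.filter fun x => (-p (h e)) x ≠ 0).card ≤ j := by
        simpa using hpj _ hh
      have h3 := card_support_add_le (Pi.single e 1) (p (t e) + -p (h e))
      have h4 := card_support_add_le (p (t e)) (-p (h e))
      have h5 := card_support_single_le e 1
      have h6 := hpj _ ht
      omega
  let q : V → E → ℝ := fun w x => (p w x : ℝ)
  -- The unit vectors of the spanned edges are independent and lie in the span of the chosen chains,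
  -- one for each vertex of the ball.
  have hli : LinearIndependent ℝ (fun e : S => (Pi.single (e : E) 1 : E → ℝ)) :=
    (Pi.linearIndependent_single_one E ℝ).comp _ Subtype.val_injective
  have hspan := linearIndependent_le_span_aux' _ hli
    (((chainBall t h v j).image q : Finset (E → ℝ)) : Set (E → ℝ)) (by
      rintro _ ⟨⟨e, he⟩, rfl⟩
      obtain ⟨ht, hh⟩ := (Finset.mem_filter.mp he).2
      have h1 : (Pi.single e 1 : E → ℝ) = q (h e) - q (t e) := by
        ext x
        have := congrArg (Int.cast : ℤ → ℝ) (congrFun (hchain e he) x)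
        simp only [Pi.single_apply, Pi.add_apply, Pi.neg_apply] at this
        simp only [Pi.single_apply, Pi.sub_apply, q]
        push_cast at this
        rw [this]
        ring
      beta_reduce
      rw [SetLike.mem_coe, h1]
      exact Submodule.sub_mem _
        (Submodule.subset_span (Finset.mem_coe.mpr (Finset.mem_image_of_mem q hh)))
        (Submodule.subset_span (Finset.mem_coe.mpr (Finset.mem_image_of_mem q ht))))
  rw [Fintype.card_coe] at hspan
  refine hspan.trans ?_
  rw [← Set.toFinset_card, Finset.toFinset_coe]
  exact Finset.card_image_le

/-- The indicator of an isolated vertex `w ≠ v` has zero coboundary, so no chain can end there. -/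
theorem valence_ne_zero_of_mem_chainBall (hv : valence t h v ≠ 0) (hw : w ∈ chainBall t h v j) :
    valence t h w ≠ 0 := by
  classical
  intro h0
  have hwv : w ≠ v := fun h1 => hv (h1 ▸ h0)
  obtain ⟨p, hp, -⟩ := mem_chainBall.mp hw
  rw [valence_eq_zero_iff] at h0
  have := hp (fun x => if x = w then 1 else 0)
  simp [h0.1, h0.2, hwv.symm] at this

/-- The ball `B_j` carries at least `3|B_j|` half-edges, and their number is that of the edges
touching `B_j` plus that of the edges inside it. At most `|B_j|` edges lie inside, so at least
`2|B_j|` touch it. These lie inside `B_{j+1}`, which contains at most `|B_{j+1}|` edges; hence the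
ball doubles. -/
theorem two_pow_le_card_chainBall (hdeg : ∀ w, valence t h w = 0 ∨ 3 ≤ valence t h w)
    (hv : valence t h v ≠ 0) {k : ℕ} (hno : ¬ HasLowRankCycle t h (2 * k + 1)) (hj : j ≤ k) :
    2 ^ j ≤ (chainBall t h v j).card := by
  classical
  induction j with
  | zero => exact Finset.card_pos.mpr ⟨v, self_mem_chainBall⟩
  | succ j ih =>
    have ih := ih (Nat.le_of_succ_le hj)
    have hmono : ∀ i ≤ k, ¬ HasLowRankCycle t h (2 * i + 1) := fun i hi ⟨z, hz, hzc, I, hI, hs⟩ =>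
      hno ⟨z, hz, hzc, I, by omega, hs⟩
    have h1 := card_edges_le_card_chainBall (v := v) (hmono j (by omega))
    have h2 := card_edges_le_card_chainBall (v := v) (hmono (j + 1) hj)
    have h3 : 3 * (chainBall t h v j).card ≤ ∑ w ∈ chainBall t h v j, valence t h w := by
      rw [mul_comm, ← smul_eq_mul, ← Finset.sum_const]
      exact Finset.sum_le_sum fun w hw =>
        (hdeg w).resolve_left (valence_ne_zero_of_mem_chainBall hv hw)
    rw [sum_valence, ← Finset.card_union_add_card_inter, ← Finset.filter_or,
      ← Finset.filter_and] at h3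
    have h4 : (Finset.univ.filter fun e => t e ∈ chainBall t h v j ∨ h e ∈ chainBall t h v j).card ≤
        (Finset.univ.filter fun e =>
          t e ∈ chainBall t h v (j + 1) ∧ h e ∈ chainBall t h v (j + 1)).card := by
      refine Finset.card_le_card fun e he => ?_
      simp only [Finset.mem_filter, Finset.mem_univ, true_and] at he ⊢
      exact mem_chainBall_succ_of_edge he
    rw [pow_succ]
    omega

open Classical in
-- Rank–nullity for the boundary map at the non-isolated vertices; isolated vertices impose no
-- condition on cycles.
theorem card_edges_le_finrank_add :
    Fintype.card E ≤ Module.finrank ℝ (cycleSpace t h) +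
      (Finset.univ.filter fun v => valence t h v ≠ 0).card := by
  set L := Finset.univ.filter fun v => valence t h v ≠ 0 with hL
  let A : (E → ℝ) →ₗ[ℝ] (L → ℝ) :=
    LinearMap.pi fun v => ∑ e, (incidence t h v.1 e : ℝ) • LinearMap.proj e
  have hA : ∀ y v, A y v = ∑ e, y e * (incidence t h v.1 e : ℝ) := fun y v => by
    simp [A, mul_comm]
  have hker : LinearMap.ker A ≤ cycleSpace t h := by
    intro y hy
    refine mem_cycleSpace_of_sum_mul_incidence fun v => ?_
    by_cases hv : v ∈ L
    · rw [← hA y ⟨v, hv⟩, LinearMap.mem_ker.mp hy, Pi.zero_apply]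
    · refine Finset.sum_eq_zero fun e _ => ?_
      have hv : valence t h v = 0 := by
        by_contra hne
        exact hv (Finset.mem_filter.mpr ⟨Finset.mem_univ _, hne⟩)
      rw [valence_eq_zero_iff] at hv
      simp [incidence, hv.1, hv.2]
  have h1 := A.finrank_range_add_finrank_ker
  have h2 := Submodule.finrank_mono hker
  have h3 := (LinearMap.range A).finrank_le
  rw [Module.finrank_fintype_fun_eq_card] at h1 h3
  rw [Fintype.card_coe] at h3
  omega

/-- The Moore bound: a multigraph with all valences at least three has a cycle of logarithmic
length. -/
theorem hasLowRankCycle_of_three_le_valence [Nonempty E]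
    (hdeg : ∀ w, valence t h w = 0 ∨ 3 ≤ valence t h w) {k : ℕ}
    (hk : 2 * Module.finrank ℝ (cycleSpace t h) < 2 ^ k) : HasLowRankCycle t h (2 * k + 1) := by
  classical
  by_contra hno
  obtain ⟨e⟩ := ‹Nonempty E›
  have hv : valence t h (t e) ≠ 0 := by
    have : 0 < (Finset.univ.filter fun x => t x = t e).card :=
      Finset.card_pos.mpr ⟨e, by simp⟩
    unfold valence
    omega
  have h1 := two_pow_le_card_chainBall hdeg hv hno le_rfl
  have h2 : (chainBall t h (t e) k).card ≤
      (Finset.univ.filter fun v => valence t h v ≠ 0).card :=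
    Finset.card_le_card fun w hw => by
      simpa using valence_ne_zero_of_mem_chainBall hv hw
  have h3 := card_edges_le_finrank_add (t := t) (h := h)
  have h4 : 3 * (Finset.univ.filter fun v => valence t h v ≠ 0).card ≤
      ∑ w ∈ Finset.univ.filter (fun v => valence t h v ≠ 0), valence t h w := by
    rw [mul_comm, ← smul_eq_mul, ← Finset.sum_const]
    exact Finset.sum_le_sum fun w hw => (hdeg w).resolve_left (Finset.mem_filter.mp hw).2
  have h5 : ∀ s : E → V, (Finset.univ.filter fun x =>
      s x ∈ Finset.univ.filter (fun v => valence t h v ≠ 0)).card ≤ Fintype.card E :=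
    fun s => Finset.card_le_univ _
  rw [sum_valence] at h4
  have h6 := h5 t
  have h7 := h5 h
  -- With `L` non-isolated vertices, `3L ≤ 2|E|` and `|E| ≤ g + L` give `L ≤ 2g`, where `g` is the
  -- rank of the cycle space. This contradicts `2 ^ k ≤ L`.
  omega

end Moore

/-- A multigraph whose first Betti number is positive and less than `2 ^ (k - 1)` has a nonzero
integral cycle whose cographic rank is at most `2 * k + 1`. -/
theorem hasLowRankCycle_of_finrank_lt {V E : Type*} [Fintype V] [Fintype E] (t h : E → V) {k : ℕ}
    (hk : 2 * Module.finrank ℝ (cycleSpace t h) < 2 ^ k) (hne : cycleSpace t h ≠ ⊥) :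
    HasLowRankCycle t h (2 * k + 1) := by
  classical
  induction hn : Fintype.card E generalizing E with
  | zero =>
    have : IsEmpty E := Fintype.card_eq_zero_iff.mp hn
    exact absurd (Subsingleton.elim _ _) hne
  | succ n ih =>
    have : Nonempty E := Fintype.card_pos_iff.mp (by omega)
    -- Valence zero must be allowed: contraction keeps the vertex type and leaves the moved vertex
    -- behind as an isolated one.
    by_cases hdeg : ∀ w, valence t h w = 0 ∨ 3 ≤ valence t h w
    · exact hasLowRankCycle_of_three_le_valence hdeg hk
    by_cases hloop : ∃ e, h e = t e
    · obtain ⟨e, he⟩ := hloop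
      exact hasLowRankCycle_of_loop (by omega) he
    push Not at hdeg hloop
    obtain ⟨v, hv0, hv3⟩ := hdeg
    -- Without loops no edge contributes two half-edges at `v`, so valence at most two leaves at
    -- most one edge besides `e`.
    have hval : valence t h v = (Finset.univ.filter fun e => t e = v ∨ h e = v).card := by
      rw [valence, ← Finset.card_union_of_disjoint, ← Finset.filter_or]
      exact Finset.disjoint_filter.mpr fun e _ h1 h2 => hloop e (h2.trans h1.symm)
    rw [hval] at hv0 hv3
    obtain ⟨e, he⟩ := Finset.card_ne_zero.mp hv0
    obtain ⟨u, huv, hev⟩ : ∃ u, u ≠ v ∧ ((h e = v ∧ t e = u) ∨ (t e = v ∧ h e = u)) := by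
      rcases (Finset.mem_filter.mp he).2 with h1 | h1
      · exact ⟨h e, fun h2 => hloop e (h2.trans h1.symm), Or.inr ⟨h1, rfl⟩⟩
      · exact ⟨t e, fun h2 => hloop e (h1.trans h2.symm), Or.inl ⟨h1, rfl⟩⟩
    have hmem : ∀ x, x ≠ e → incidence t h v x ≠ 0 →
        x ∈ (Finset.univ.filter fun e => t e = v ∨ h e = v).erase e := by
      intro x hx hi
      refine Finset.mem_erase.mpr ⟨hx, Finset.mem_filter.mpr ⟨Finset.mem_univ _, ?_⟩⟩
      by_contra! hcon
      exact hi (by simp [incidence, hcon.1, hcon.2])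
    have hcard : ((Finset.univ.filter fun e => t e = v ∨ h e = v).erase e).card ≤ 1 := by
      rw [Finset.card_erase_of_mem he]
      omega
    refine HasLowRankCycle.of_contract huv hev
      (fun x x' hx hx' hi hi' => Finset.card_le_one.mp hcard _ (hmem x hx hi) _ (hmem x' hx' hi'))
      (ih _ _ ?_ (contract_ne_bot huv hev hne) ?_)
    · exact (Nat.mul_le_mul_left 2 (finrank_contract_le huv hev)).trans_lt hk
    · rw [Fintype.card_subtype_compl, Fintype.card_subtype_eq, hn]
      rfl

/-! ### Principal shift divisors. -/

/-- The jump of the derivative of a ramp, concentrated at its corner. -/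
theorem ite_le_sub_ite_lt (x t : ℝ) :
    (if x ≤ t then (1 : ℝ) else 0) - (if x < t then 1 else 0) = if x = t then 1 else 0 := by
  rcases lt_trichotomy x t with h | h | h
  · simp [h, h.le, h.ne]
  · simp [h]
  · simp [h.not_ge, h.not_gt, h.ne']

namespace MetricGraph

variable {V E : Type*} [Fintype E] {Γ : MetricGraph V E}

/-- Pairing the boundary of `y` with a vertex function gives the defining sum of `cycleSpace`;
indicators recover each coefficient. -/
theorem mem_ker_boundary_iff (y : E →₀ ℝ) :
    y ∈ LinearMap.ker Γ.boundary ↔ (y : E → ℝ) ∈ cycleSpace Γ.tail Γ.head := by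
  classical
  have key : ∀ f : V → ℝ, Finsupp.linearCombination ℝ f (Γ.boundary y) =
      ∑ e, y e * (f (Γ.head e) - f (Γ.tail e)) := by
    intro f
    simp only [boundary, Finsupp.linearCombination_apply, map_finsuppSum, map_smul]
    rw [Finsupp.sum_fintype _ _ (by simp)]
    simp [Finsupp.sum_sub_index, sub_mul]
  rw [LinearMap.mem_ker, mem_cycleSpace]
  refine ⟨fun h f => by rw [← key, h, map_zero], fun h => ?_⟩
  ext v
  have h1 := (key fun w => if w = v then 1 else 0).trans (h fun w => if w = v then 1 else 0)
  simpa [Finsupp.linearCombination_apply, Finsupp.sum, Finsupp.mem_support_iff] using h1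

theorem genus_eq_finrank_cycleSpace :
    Γ.genus = Module.finrank ℝ (cycleSpace Γ.tail Γ.head) := by
  refine LinearEquiv.finrank_eq
    ((Finsupp.linearEquivFunOnFinite ℝ ℝ E).ofSubmodules _ _ (le_antisymm ?_ fun y hy => ?_))
  · rintro _ ⟨y, hy, rfl⟩
    exact (mem_ker_boundary_iff y).mp hy
  · exact ⟨(Finsupp.linearEquivFunOnFinite ℝ ℝ E).symm y,
      (mem_ker_boundary_iff _).mpr (by simpa using hy), by simp⟩

/-- The divisor moving one point on each edge `e` from position `a e` to position `b e`. -/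
def shiftDivisor (Γ : MetricGraph V E) (a b : E → ℝ) : Γ.Divisor :=
  ∑ e, (Finsupp.single (Γ.edgePoint e (b e)) 1 - Finsupp.single (Γ.edgePoint e (a e)) 1)

variable {a b : E → ℝ}

theorem shiftDivisor_apply_vertex (ha : ∀ e, a e ∈ Set.Ioo 0 (Γ.length e))
    (hb : ∀ e, b e ∈ Set.Ioo 0 (Γ.length e)) (v : V) :
    Γ.shiftDivisor a b (Point.vertex v) = 0 := by
  classical
  simp [shiftDivisor, edgePoint_of_mem (ha _), edgePoint_of_mem (hb _)]

theorem shiftDivisor_apply_interior (ha : ∀ e, a e ∈ Set.Ioo 0 (Γ.length e))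
    (hb : ∀ e, b e ∈ Set.Ioo 0 (Γ.length e)) (e : E) (t : ℝ) (ht : t ∈ Set.Ioo 0 (Γ.length e)) :
    Γ.shiftDivisor a b (Point.interior e t ht) =
      (if b e = t then 1 else 0) - (if a e = t then 1 else 0) := by
  classical
  rw [shiftDivisor, Finsupp.finsetSum_apply, Finset.sum_eq_single e]
  · simp [edgePoint_of_mem (ha _), edgePoint_of_mem (hb _), Finsupp.single_apply]
  · intro e' _ hne
    simp [edgePoint_of_mem (ha _), edgePoint_of_mem (hb _), hne]
  · simp

section Outgoing

variable {f : Γ.Point → ℝ} {c : E → ℝ} {m : E → ℤ} {n : ℤ}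

theorem outgoingSlope_interior_of_eqOn
    (hf : ∀ e, ∀ s ∈ Set.Icc 0 (Γ.length e),
      f (Γ.edgePoint e s) = c e + m e * s + n * (ramp (a e) s - ramp (b e) s))
    (e : E) (t : ℝ) (ht : t ∈ Set.Ioo 0 (Γ.length e)) :
    Γ.outgoingSlope f (Point.interior e t ht) =
      n * ((if a e = t then 1 else 0) - (if b e = t then 1 else 0)) := by
  rw [outgoingSlope, slopeForward_of_eqOn (hf e) ht.1.le ht.2,
    slopeBackward_of_eqOn (hf e) ht.1 ht.2.le, ← ite_le_sub_ite_lt, ← ite_le_sub_ite_lt]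
  ring

theorem outgoingSlope_vertex_of_eqOn [DecidableEq V] (ha : ∀ e, a e ∈ Set.Ioo 0 (Γ.length e))
    (hb : ∀ e, b e ∈ Set.Ioo 0 (Γ.length e))
    (hf : ∀ e, ∀ s ∈ Set.Icc 0 (Γ.length e),
      f (Γ.edgePoint e s) = c e + m e * s + n * (ramp (a e) s - ramp (b e) s)) (v : V) :
    Γ.outgoingSlope f (Point.vertex v) =
      -∑ e, (m e : ℝ) * (incidence Γ.tail Γ.head v e : ℝ) := by
  have h1 : ∀ e, Γ.slopeForward f e 0 = m e := fun e => by
    rw [slopeForward_of_eqOn (hf e) le_rfl (Γ.length_pos e)]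
    simp [(ha e).1.not_ge, (hb e).1.not_ge]
  have h2 : ∀ e, Γ.slopeBackward f e (Γ.length e) = -m e := fun e => by
    rw [slopeBackward_of_eqOn (hf e) (Γ.length_pos e) le_rfl]
    simp [(ha e).2, (hb e).2]
  simp only [outgoingSlope, h1, h2]
  rw [← Finset.sum_add_distrib, ← Finset.sum_neg_distrib]
  refine Finset.sum_congr rfl fun e _ => ?_
  unfold incidence
  split_ifs <;> simp_all

end Outgoing

/-- A multiple of a shift divisor is principal if it is balanced by an integral cycle. -/
theorem zsmul_shiftDivisor_mem_principal (ha : ∀ e, a e ∈ Set.Ioo 0 (Γ.length e))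
    (hb : ∀ e, b e ∈ Set.Ioo 0 (Γ.length e)) {n : ℤ} {m : E → ℤ}
    (hm : (fun e => (m e : ℝ)) ∈ cycleSpace Γ.tail Γ.head)
    (hmb : ∀ y ∈ cycleSpace Γ.tail Γ.head,
      ∑ e, (m e * Γ.length e + n * (b e - a e)) * y e = 0) :
    n • Γ.shiftDivisor a b ∈ Γ.principal := by
  classical
  obtain ⟨p, hp⟩ := exists_potential _ _ _ hmb
  -- Slope `m e` near both ends, with corners of size `n` and `-n` at `a e` and `b e`. The value at
  -- the head matches because `p` increases by `m e * length e + n * (b e - a e)` along `e`.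
  let F : E → ℝ → ℝ := fun e s => p (Γ.tail e) + m e * s + n * (ramp (a e) s - ramp (b e) s)
  let f : Γ.Point → ℝ := fun x => match x with
    | Point.vertex v => p v
    | Point.interior e t _ => F e t
  have hf : ∀ e, ∀ s ∈ Set.Icc 0 (Γ.length e), f (Γ.edgePoint e s) = F e s := by
    intro e s hs
    rcases hs.1.eq_or_lt with h0 | h0
    · rw [← h0, edgePoint_zero]
      simp [f, F, ramp_of_le (ha e).1.le, ramp_of_le (hb e).1.le]
    rcases hs.2.eq_or_lt with h1 | h1
    · rw [h1, edgePoint_length]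
      simp only [f, F, ramp_of_ge (ha e).2.le, ramp_of_ge (hb e).2.le]
      linear_combination hp e
    · rw [edgePoint_of_mem ⟨h0, h1⟩]
  refine ⟨f, fun e => ?_, fun x => ?_⟩
  · refine PLOn.congr ?_ (hf e)
    have h1 := (plOn_affine (p (Γ.tail e)) (m e) (Γ.length e)).add
      (((plOn_ramp (a e) _).add ((plOn_ramp (b e) _).int_mul (-1))).int_mul n)
    exact h1.congr fun s _ => by simp only [F]; push_cast; ring
  · cases x with
    | vertex v =>
      rw [outgoingSlope_vertex_of_eqOn ha hb hf, sum_mul_incidence_of_mem hm v]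
      simp [shiftDivisor_apply_vertex ha hb]
    | interior e t ht =>
      rw [outgoingSlope_interior_of_eqOn hf, Finsupp.smul_apply,
        shiftDivisor_apply_interior ha hb]
      simp only [smul_eq_mul]
      push_cast
      ring

/-- A principal shift divisor is balanced by an integral cycle. -/
theorem exists_cycle_of_shiftDivisor_mem_principal [Fintype V]
    (ha : ∀ e, a e ∈ Set.Ioo 0 (Γ.length e)) (hb : ∀ e, b e ∈ Set.Ioo 0 (Γ.length e))
    (h : Γ.shiftDivisor a b ∈ Γ.principal) :
    ∃ m : E → ℤ, (fun e => (m e : ℝ)) ∈ cycleSpace Γ.tail Γ.head ∧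
      ∀ y ∈ cycleSpace Γ.tail Γ.head, ∑ e, (m e * Γ.length e + (b e - a e)) * y e = 0 := by
  classical
  obtain ⟨f, hf, hdiv⟩ := h
  have haff : ∀ e, ∃ m : ℤ, ∀ s ∈ Set.Icc 0 (Γ.length e), f (Γ.edgePoint e s) =
      f (Point.vertex (Γ.tail e)) + m * s + (1 : ℤ) * (ramp (a e) s - ramp (b e) s) := by
    intro e
    -- Subtracting the ramps that carry the prescribed divisor leaves a function without kinks
    -- inside the edge, hence affine of integer slope.
    have hG : PLOn (fun s => f (Γ.edgePoint e s) + (ramp (b e) s - ramp (a e) s))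
        (Γ.length e) := by
      have h1 : PLOn (fun s => f (Γ.edgePoint e s)) (Γ.length e) := hf e
      refine (h1.add ((plOn_ramp (b e) _).add ((plOn_ramp (a e) _).int_mul (-1)))).congr
        fun s _ => ?_
      push_cast
      ring
    obtain ⟨m, hm⟩ := hG.affine (Γ.length_pos e).le fun t ht => by
      have hr := (hf.differentiableWithinAt_Ici ht.1.le ht.2).hasDerivWithinAt.add
        ((hasDerivWithinAt_ramp_Ici (b e) t).sub (hasDerivWithinAt_ramp_Ici (a e) t))
      have hl := (hf.differentiableWithinAt_Iic ht.1 ht.2.le).hasDerivWithinAt.add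
        ((hasDerivWithinAt_ramp_Iic (b e) t).sub (hasDerivWithinAt_ramp_Iic (a e) t))
      have hr' := hr.derivWithin (uniqueDiffWithinAt_Ici t)
      have hl' := hl.derivWithin (uniqueDiffWithinAt_Iic t)
      have hx := hdiv (Point.interior e t ht)
      rw [shiftDivisor_apply_interior ha hb, outgoingSlope, slopeForward, slopeBackward] at hx
      push_cast at hx
      rw [← ite_le_sub_ite_lt, ← ite_le_sub_ite_lt] at hx
      refine hr'.trans (Eq.trans ?_ hl'.symm)
      linarith
    refine ⟨m, fun s hs => ?_⟩
    have h1 := hm s hs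
    rw [edgePoint_zero, ramp_of_le (ha e).1.le, ramp_of_le (hb e).1.le] at h1
    push_cast
    linarith
  choose m hm using haff
  refine ⟨m, mem_cycleSpace_of_sum_mul_incidence fun v => ?_, fun y hy => ?_⟩
  · have h1 := hdiv (Point.vertex v)
    rw [outgoingSlope_vertex_of_eqOn ha hb hm, shiftDivisor_apply_vertex ha hb] at h1
    simpa using h1.symm
  -- The balancing cochain is the coboundary of `f` restricted to the vertices.
  · rw [← hy fun v => f (Point.vertex v)]
    refine Finset.sum_congr rfl fun e _ => ?_
    have h1 := hm e (Γ.length e) ⟨(Γ.length_pos e).le, le_rfl⟩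
    rw [edgePoint_length, ramp_of_ge (ha e).2.le, ramp_of_ge (hb e).2.le] at h1
    rw [h1]
    push_cast
    ring

end MetricGraph

/-! ### Infinitely many torsion points from one cycle. -/

/-- A functional that is a combination of coordinates in `I` is a combination of linearly
independent coordinates in `I`. -/
theorem exists_independent_coordinates {E : Type*} (H : Submodule ℝ (E → ℝ))
    (φ : (E → ℝ) → ℝ) (I : Finset E) (c : E → ℝ) (hc : ∀ y ∈ H, φ y = ∑ i ∈ I, c i * y i) :
    ∃ J ⊆ I, ∃ c' : E → ℝ, (∀ y ∈ H, φ y = ∑ i ∈ J, c' i * y i) ∧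
      ∀ s : E → ℝ, (∀ y ∈ H, ∑ i ∈ J, s i * y i = 0) → ∀ i ∈ J, s i = 0 := by
  classical
  induction I using Finset.strongInduction generalizing c with
  | H I ih =>
    by_cases hind : ∀ s : E → ℝ, (∀ y ∈ H, ∑ i ∈ I, s i * y i = 0) → ∀ i ∈ I, s i = 0
    · exact ⟨I, subset_rfl, c, hc, hind⟩
    push Not at hind
    obtain ⟨s, hs, j, hj, hsj⟩ := hind
    -- Subtracting `c j / s j` times the relation `s` removes the coordinate `j`.
    obtain ⟨J, hJ, c', hc', hJind⟩ := ih (I.erase j) (Finset.erase_ssubset hj)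
      (fun i => c i - c j / s j * s i) (fun y hy => by
        have h1 : ∑ i ∈ I, (c i - c j / s j * s i) * y i = φ y := by
          simp only [sub_mul, Finset.sum_sub_distrib, mul_assoc, ← Finset.mul_sum, hs y hy,
            hc y hy, mul_zero, sub_zero]
        rw [← h1, ← Finset.add_sum_erase _ _ hj]
        field_simp
        simp)
    exact ⟨J, hJ.trans (Finset.erase_subset _ _), c', hc', hJind⟩

namespace MetricGraph

variable {V E : Type*} [Fintype E] {Γ : MetricGraph V E}

/-- The integral cycle balancing a small shift vanishes. -/
theorem eq_zero_of_balanced {m : E → ℤ} {δ : E → ℝ} (hδ : ∀ e, |δ e| < Γ.length e)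
    (hm : (fun e => (m e : ℝ)) ∈ cycleSpace Γ.tail Γ.head)
    (hmb : ∀ y ∈ cycleSpace Γ.tail Γ.head, ∑ e, (m e * Γ.length e + δ e) * y e = 0) : m = 0 := by
  -- The balance condition is tested on `m` itself: `|m e| ≥ 1` and `|δ e| < length e` make every
  -- term with `m e ≠ 0` positive.
  have hpos : ∀ e, m e ≠ 0 → 0 < ((m e : ℝ) * Γ.length e + δ e) * m e := by
    intro e he
    have h1 : (1 : ℝ) ≤ |(m e : ℝ)| := by exact_mod_cast Int.one_le_abs he
    have h2 : -(|δ e| * |(m e : ℝ)|) ≤ δ e * m e := by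
      rw [← abs_mul]
      exact neg_abs_le _
    have h3 : |δ e| * |(m e : ℝ)| < Γ.length e * |(m e : ℝ)| :=
      mul_lt_mul_of_pos_right (hδ e) (by linarith)
    have h4 : Γ.length e * |(m e : ℝ)| ≤ Γ.length e * (|(m e : ℝ)| * |(m e : ℝ)|) :=
      mul_le_mul_of_nonneg_left (by nlinarith) (Γ.length_pos e).le
    rw [abs_mul_abs_self] at h4
    nlinarith
  have hnonneg : ∀ e ∈ Finset.univ, 0 ≤ ((m e : ℝ) * Γ.length e + δ e) * m e := fun e _ => by
    by_cases he : m e = 0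
    · simp [he]
    · exact (hpos e he).le
  have hzero := (Finset.sum_eq_zero_iff_of_nonneg hnonneg).mp (hmb _ hm)
  ext e
  by_contra he
  exact (hpos e he).ne' (hzero e (Finset.mem_univ e))

/-- One point on each edge in `I`, at the positions `a`, and `r` times the vertex `v`. -/
def edgeConfig (Γ : MetricGraph V E) (I : Finset E) (r : ℕ) (v : V) (a : E → ℝ) :
    Fin (I.card + r) → Γ.Point :=
  Fin.append (fun j => Γ.edgePoint (I.equivFin.symm j) (a (I.equivFin.symm j)))
    (fun _ => Point.vertex v)

theorem pointSum_edgeConfig_sub (I : Finset E) (r : ℕ) (v : V) {a b : E → ℝ}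
    (hab : ∀ e, e ∉ I → a e = b e) :
    Γ.pointSum (Γ.edgeConfig I r v b) - Γ.pointSum (Γ.edgeConfig I r v a) =
      Γ.shiftDivisor a b := by
  have h1 : ∀ a : E → ℝ, Γ.pointSum (Γ.edgeConfig I r v a) =
      ∑ e ∈ I, Finsupp.single (Γ.edgePoint e (a e)) 1 +
        ∑ _j : Fin r, Finsupp.single (Point.vertex v) 1 := by
    intro a
    rw [pointSum, Fin.sum_univ_add]
    simp only [edgeConfig, Fin.append_left, Fin.append_right]
    rw [← Finset.sum_coe_sort I]
    congr 1
    exact Equiv.sum_comp I.equivFin.symm fun e : I =>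
      (Finsupp.single (Γ.edgePoint e (a e)) 1 : Γ.Divisor)
  rw [h1, h1, add_sub_add_right_eq_sub, ← Finset.sum_sub_distrib, shiftDivisor]
  exact Finset.sum_subset (Finset.subset_univ I) fun e _ he => by rw [hab e he, sub_self]

/-- If the functional `y ↦ ⟨z, y⟩` of a nonzero integral cycle `z` is a combination of at most `d`
coordinates, then the Manin--Mumford condition fails in degree `d`. -/
theorem not_maninMumford_of_cycle [Fintype V] {d : ℕ} {z : E → ℤ} (hz : z ≠ 0)
    (hzc : (fun e => (z e : ℝ)) ∈ cycleSpace Γ.tail Γ.head) {I : Finset E} (hI : I.card ≤ d)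
    {c : E → ℝ} (hc : ∀ y ∈ cycleSpace Γ.tail Γ.head,
      ∑ e, z e * Γ.length e * y e = ∑ i ∈ I, c i * y i) : ¬ Γ.ManinMumford d := by
  classical
  obtain ⟨J, hJ, c', hc', hind⟩ := exists_independent_coordinates _
    (fun y => ∑ e, z e * Γ.length e * y e) I c hc
  -- The `r` spare points stay at a vertex and cancel against the base divisor.
  obtain ⟨r, rfl⟩ := Nat.exists_eq_add_of_le ((Finset.card_le_card hJ).trans hI)
  let w : E → ℝ := fun e => if e ∈ J then c' e else 0
  have hwJ : ∀ e, e ∉ J → w e = 0 := fun e he => if_neg he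
  have hw : ∀ y ∈ cycleSpace Γ.tail Γ.head, ∑ e, z e * Γ.length e * y e = ∑ e, w e * y e := by
    intro y hy
    rw [hc' y hy]
    simp [w, ite_mul]
  -- If `w` vanished, pairing `z` with itself would give `∑ z e ^ 2 * length e = 0`.
  obtain ⟨e₀, he₀⟩ : ∃ e, w e ≠ 0 := by
    by_contra! hw0
    have h1 := hw _ hzc
    simp only [hw0, zero_mul, Finset.sum_const_zero] at h1
    have hnonneg : ∀ e ∈ Finset.univ, 0 ≤ (z e : ℝ) * Γ.length e * z e := fun e _ => by
      nlinarith [mul_self_nonneg (z e : ℝ), Γ.length_pos e,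
        mul_nonneg (mul_self_nonneg (z e : ℝ)) (Γ.length_pos e).le]
    refine hz (funext fun e => ?_)
    have h2 := (Finset.sum_eq_zero_iff_of_nonneg hnonneg).mp h1 e (Finset.mem_univ e)
    simpa [(Γ.length_pos e).ne'] using h2
  -- A quarter of the length keeps the displaced midpoints inside their edges and makes any two
  -- displacements differ by less than the length.
  have hlim : ∀ᶠ n : ℕ in Filter.atTop, ∀ e, |w e / n| < Γ.length e / 4 := by
    refine Filter.eventually_all.mpr fun e => ?_
    have h1 := (tendsto_const_div_atTop_nhds_zero_nat (w e)).abs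
    rw [abs_zero] at h1
    exact h1.eventually_lt_const (by linarith [Γ.length_pos e])
  obtain ⟨N, hN⟩ := Filter.eventually_atTop.mp hlim
  let a : E → ℝ := fun e => Γ.length e / 2
  let b : ℕ → E → ℝ := fun n e => Γ.length e / 2 - w e / n
  have ha : ∀ e, a e ∈ Set.Ioo 0 (Γ.length e) := fun e => by
    have := Γ.length_pos e
    constructor <;> simp only [a] <;> linarith
  have hb : ∀ n, N ≤ n → ∀ e, b n e ∈ Set.Ioo 0 (Γ.length e) := fun n hn e => by
    have h1 := abs_lt.mp (hN n hn e)
    have := Γ.length_pos e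
    constructor <;> simp only [b] <;> linarith
  have hab : ∀ n e, e ∉ J → a e = b n e := fun n e he => by simp [a, b, hwJ e he]
  obtain ⟨v⟩ := Γ.nonempty
  let D := Γ.pointSum (Γ.edgeConfig J r v a)
  have hD : Γ.degree D = (J.card + r : ℕ) := degree_pointSum _ _
  intro hMM
  have hD0 : 0 ≤ D := Finset.sum_nonneg fun i _ => Finsupp.single_nonneg.mpr zero_le_one
  refine (Set.infinite_of_injOn_mapsTo (s := Set.Ici (N + 1))
    (f := fun n => Γ.abelJacobi D hD (Γ.edgeConfig J r v (b n))) ?_ ?_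
    (Set.Ici_infinite (N + 1))) (hMM D hD hD0)
  · intro n hn n' hn' heq
    have hn : N + 1 ≤ n := hn
    have hn' : N + 1 ≤ n' := hn'
    have h1 : Γ.shiftDivisor (b n) (b n') ∈ Γ.principal := by
      have h2 := QuotientAddGroup.eq.mp heq
      rw [AddSubgroup.mem_addSubgroupOf] at h2
      rw [← pointSum_edgeConfig_sub J r v fun e he => (hab n e he).symm.trans (hab n' e he)]
      convert h2 using 1
      simp only [AddSubgroup.coe_add, NegMemClass.coe_neg]
      abel
    obtain ⟨m, hm, hmb⟩ := exists_cycle_of_shiftDivisor_mem_principal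
      (hb n (by omega)) (hb n' (by omega)) h1
    have hm0 : m = 0 := by
      refine eq_zero_of_balanced (fun e => ?_) hm hmb
      have h2 := abs_lt.mp (hN n (by omega) e)
      have h3 := abs_lt.mp (hN n' (by omega) e)
      have := Γ.length_pos e
      simp only [b]
      rw [abs_lt]
      constructor <;> linarith
    -- With `m = 0` the displacement difference annihilates all cycles, so independence of the
    -- coordinates in `J` makes it zero.
    have hdiff : ∀ e ∈ J, b n' e - b n e = 0 := hind _ fun y hy => by
      rw [← hmb y hy]
      refine (Finset.sum_subset (Finset.subset_univ J) fun e _ he => ?_).trans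
        (Finset.sum_congr rfl fun e _ => by simp [hm0])
      rw [← hab n e he, ← hab n' e he]
      ring
    have h4 := hdiff e₀ (by by_contra h; exact he₀ (hwJ e₀ h))
    have hn0 : (n : ℝ) ≠ 0 := Nat.cast_ne_zero.mpr (by omega)
    have hn0' : (n' : ℝ) ≠ 0 := Nat.cast_ne_zero.mpr (by omega)
    have h5 : w e₀ / n = w e₀ / n' := by simp only [b] at h4; linarith
    rw [div_eq_div_iff hn0 hn0'] at h5
    exact_mod_cast (mul_left_cancel₀ he₀ h5).symm
  · intro n hn
    have hn : N + 1 ≤ n := hn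
    refine ⟨Set.mem_range_self _, n, by omega, ?_⟩
    change n • (QuotientAddGroup.mk ⟨Γ.pointSum (Γ.edgeConfig J r v (b n)) - D, _⟩ : Γ.Jac) = 0
    rw [← QuotientAddGroup.mk_nsmul, QuotientAddGroup.eq_zero_iff,
      AddSubgroup.mem_addSubgroupOf]
    simp only [AddSubgroup.coe_nsmul]
    rw [pointSum_edgeConfig_sub J r v (hab n), ← natCast_zsmul]
    -- Since `n * (b n e - a e) = -w e`, the condition with `m = z` is exactly `hw`.
    refine zsmul_shiftDivisor_mem_principal ha (hb n (by omega)) hzc fun y hy => ?_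
    have hn0 : (n : ℝ) ≠ 0 := Nat.cast_ne_zero.mpr (by omega)
    rw [← sub_eq_zero.mpr (hw y hy), ← Finset.sum_sub_distrib]
    refine Finset.sum_congr rfl fun e _ => ?_
    simp only [a, b]
    push_cast
    field_simp
    ring

/-- Grouping the support of `z` by representative in `I` writes `⟨z, ·⟩` as a combination of the
coordinates in `I`. The lengths only affect the coefficients, so the rank condition is purely
combinatorial. -/
theorem not_maninMumford_of_hasLowRankCycle [Fintype V] {d : ℕ}
    (h : HasLowRankCycle Γ.tail Γ.head d) : ¬ Γ.ManinMumford d := by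
  classical
  obtain ⟨z, hz, hzc, I, hI, hspan⟩ := h
  choose! i hi c hc using hspan
  refine not_maninMumford_of_cycle hz hzc hI
    (c := fun j => ∑ e ∈ Finset.univ.filter (fun e => z e ≠ 0 ∧ i e = j),
      z e * Γ.length e * c e) fun y hy => ?_
  calc ∑ e, z e * Γ.length e * y e
      = ∑ e ∈ Finset.univ.filter (fun e => z e ≠ 0), z e * Γ.length e * y e :=
        (Finset.sum_filter_of_ne (p := fun e => z e ≠ 0) fun e _ h0 h1 => h0 (by simp [h1])).symm
    _ = ∑ j ∈ I, ∑ e ∈ (Finset.univ.filter (fun e => z e ≠ 0)).filter (fun e => i e = j),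
          z e * Γ.length e * y e :=
        (Finset.sum_fiberwise_of_maps_to (fun e he => hi e (Finset.mem_filter.mp he).2) _).symm
    _ = _ := by
        refine Finset.sum_congr rfl fun j _ => ?_
        rw [Finset.filter_filter, Finset.sum_mul]
        refine Finset.sum_congr rfl fun e he => ?_
        obtain ⟨-, hze, rfl⟩ := Finset.mem_filter.mp he
        rw [hc e hze y hy]
        ring

end MetricGraph

/-! ### Genus one and the final estimate. -/

/-- On a one-dimensional cycle space all coordinates in the support of a cycle are proportional. -/
theorem HasLowRankCycle.of_finrank_eq_one {V E : Type*} [Fintype E] {t h : E → V} {N d : ℕ}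
    (hc : HasLowRankCycle t h N) (h1 : Module.finrank ℝ (cycleSpace t h) = 1) (hd : 1 ≤ d) :
    HasLowRankCycle t h d := by
  classical
  obtain ⟨z, hz, hzc, -⟩ := hc
  obtain ⟨i, hi⟩ := Function.ne_iff.mp hz
  have hi : (z i : ℝ) ≠ 0 := Int.cast_ne_zero.mpr hi
  refine ⟨z, hz, hzc, {i}, by simpa using hd, fun e _ =>
    ⟨i, Finset.mem_singleton_self i, z e / z i, fun y hy => ?_⟩⟩
  have hne : (⟨_, hzc⟩ : cycleSpace t h) ≠ 0 := fun h0 =>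
    hi (congrFun (congrArg Subtype.val h0) i)
  obtain ⟨s, hs⟩ := (finrank_eq_one_iff_of_nonzero' _ hne).mp h1 ⟨y, hy⟩
  have hs : ∀ x, s * z x = y x := fun x => congrFun (congrArg Subtype.val hs) x
  rw [← hs, ← hs]
  field_simp

end

theorem mainTheorem7 :
    ∃ M : ℝ, ∀ (V E : Type*) [Fintype V] [Fintype E] (Γ : MetricGraph V E) (d : ℕ),
      1 ≤ Γ.genus → 1 ≤ d → Γ.ManinMumford d → (d : ℝ) < M * Real.log (Γ.genus : ℝ) := by
  -- With `k = Nat.log 2 g + 2` the cycle has rank at most `2 * k + 1 = 2 * Nat.log 2 g + 5`, which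
  -- is at most `7 * Nat.log 2 g` once `g ≥ 2`.
  refine ⟨7 / Real.log 2, fun V E _ _ Γ d hg hd hMM => ?_⟩
  have hgen := Γ.genus_eq_finrank_cycleSpace
  set g := Γ.genus
  have hk : 2 * Module.finrank ℝ (cycleSpace Γ.tail Γ.head) < 2 ^ (Nat.log 2 g + 2) := by
    rw [← hgen, pow_succ]
    have := Nat.lt_pow_succ_log_self one_lt_two g
    rw [Nat.succ_eq_add_one] at this
    omega
  have hne : cycleSpace Γ.tail Γ.head ≠ ⊥ := fun h0 => by
    rw [h0, finrank_bot] at hgen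
    omega
  have hcyc := hasLowRankCycle_of_finrank_lt _ _ hk hne
  -- For `g = 1` the bound reads `d < 0`, so Manin–Mumford must fail for every `d ≥ 1`.
  rcases hg.eq_or_lt with h1 | h1
  · exact absurd hMM (MetricGraph.not_maninMumford_of_hasLowRankCycle
      (hcyc.of_finrank_eq_one (hgen.symm.trans h1.symm) hd))
  by_contra! hle
  refine MetricGraph.not_maninMumford_of_hasLowRankCycle ?_ hMM
  obtain ⟨z, hz, hzc, I, hI, hspan⟩ := hcyc
  refine ⟨z, hz, hzc, I, hI.trans ?_, hspan⟩
  have hlog1 : 1 ≤ Nat.log 2 g := Nat.log_pos one_lt_two h1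
  have hl2 : 0 < Real.log 2 := Real.log_pos one_lt_two
  have hlog : (Nat.log 2 g : ℝ) * Real.log 2 ≤ Real.log g := by
    rw [← Real.log_pow]
    refine Real.log_le_log (by positivity) ?_
    exact_mod_cast Nat.pow_log_le_self 2 (by omega)
  have h7 : (7 * Nat.log 2 g : ℝ) ≤ d := by
    refine le_trans ?_ hle
    rw [div_mul_eq_mul_div, le_div_iff₀ hl2]
    linarith
  have h7 : 7 * Nat.log 2 g ≤ d := by exact_mod_cast h7
  omega
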